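/- Let $\mathcal X$ be a real Banach space that is smooth, i.e. its norm is Gâteaux differentiable at every $\mathbf x\neq \mathbf 0$. Write $\mathrm{SGN}_{\mathbf x}\in\mathcal X^*$ for the Gâteaux derivative of the norm at $\mathbf x\ne \mathbf 0$, i.e. $\mathrm{SGN}_{\mathbf x}(\mathbf h)=\lim_{t\to0}t^{-1}(\|\mathbf x+t\mathbf h\|-\|\mathbf x\|)$ for all $\mathbf h\in\mathcal X$, and put $\mathrm{SGN}_{\mathbf 0}=\mathbf 0$. Assume that the dual space $\mathcal X^*$ (with its norm) is separable and of type $2$: there is a constant $b>0$ such that $E\|\sum_{i=1}^n \mathbf U_i\|^2\le b\sum_{i=1}^n E\|\mathbf U_i\|^2$ for all $n\geq 1$ and all independent zero-mean random elements $\mathbf U_1,\dots,\mathbf U_n$ of $\mathcal X^*$ with $E\|\mathbf U_i\|^2<\infty$ for every $i$. Let $P$ and $Q$ be any two Borel probability measures on $\mathcal X$, and let $\mathbf X\sim P$ and $\mathbf Y\sim Q$ be independent. Put $\mu=E(\mathrm{SGN}_{\mathbf Y-\mathbf X})\in\mathcal X^*$ (Bochner expectation) and, for $\mathbf f,\mathbf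 g\in\mathcal X^{**}$, $$\Gamma_1(\mathbf f,\mathbf g)=E\big[\mathbf f\{E(\mathrm{SGN}_{\mathbf Y-\mathbf X}\mid\mathbf X)\}\,\mathbf g\{E(\mathrm{SGN}_{\mathbf Y-\mathbf X}\mid\mathbf X)\}\big]-\mathbf f(\mu)\mathbf g(\mu),$$ $$\Gamma_2(\mathbf f,\mathbf g)=E\big[\mathbf f\{E(\mathrm{SGN}_{\mathbf Y-\mathbf X}\mid\mathbf Y)\}\,\mathbf g\{E(\mathrm{SGN}_{\mathbf Y-\mathbf X}\mid\mathbf Y)\}\big]-\mathbf f(\mu)\mathbf g(\mu).$$ For independent observations $\mathbf X_1,\dots,\mathbf X_m$ from $P$ and $\mathbf Y_1,\dots,\mathbf Y_n$ from $Q$ (the two samples also being independent of each other), let $T_{WMW}=(mn)^{-1}\sum_{i=1}^m\sum_{j=1}^n \mathrm{SGN}_{\mathbf Y_j-\mathbf X_i}$ and $N=m+n$. If $m,n\to\infty$ in such a way that $m/N\to\gamma\in(0,1)$, then there is a Gaussian distribution $G\{\mathbf 0,(1-\gamma)\Gamma_1+\gamma\Gamma_2\}$ on $\mathcal X^*$ with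 mean $\mathbf 0$ and covariance $(1-\gamma)\Gamma_1+\gamma\Gamma_2$, and $(mn/N)^{1/2}(T_{WMW}-\mu)$ converges weakly in $\mathcal X^*$ (with its norm topology) to it. -/

import Mathlib

open MeasureTheory ProbabilityTheory Filter Topology

universe u v

/-- `L` is the Gâteaux derivative at `x` of the norm of `E`:
`(‖x + t • h‖ - ‖x‖) / t → L h` as `t → 0`, for every direction `h`. -/
def IsGateauxDerivNorm {E : Type u} [NormedAddCommGroup E] [NormedSpace ℝ E]
    (L : StrongDual ℝ E) (x : E) : Prop :=
  ∀ h : E, HasLineDerivAt ℝ (fun z : E => ‖z‖) (L h) x h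

/-- A normed space is smooth if its norm is Gâteaux differentiable at every nonzero point. -/
def IsSmoothSpace (E : Type u) [NormedAddCommGroup E] [NormedSpace ℝ E] : Prop :=
  ∀ x : E, x ≠ 0 → ∃ L : StrongDual ℝ E, IsGateauxDerivNorm L x

open Classical in
/-- The spatial sign `SGN x`: the Gâteaux derivative of the norm at `x` if `x ≠ 0`, and `0` if
`x = 0` (also `0`, by convention, at points where the norm is not Gâteaux differentiable; there are
none in a smooth space). -/
noncomputable def SGN {E : Type u} [NormedAddCommGroup E] [NormedSpace ℝ E] (x : E) :
    StrongDual ℝ E :=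
  if h : x ≠ 0 ∧ ∃ L : StrongDual ℝ E, IsGateauxDerivNorm L x then h.2.choose else 0

/-- `F` is of type 2: there is `b > 0` such that `E ‖∑ Uᵢ‖² ≤ b ∑ E ‖Uᵢ‖²` for all finite families
of independent, centered random elements of `F` with finite second moments. -/
def IsTypeTwo (F : Type u) [NormedAddCommGroup F] [NormedSpace ℝ F] [MeasurableSpace F]
    [BorelSpace F] : Prop :=
  ∃ b : ℝ, 0 < b ∧
    ∀ (Ω : Type u) [MeasurableSpace Ω] (ρ : Measure Ω) [IsProbabilityMeasure ρ]
      (n : ℕ) (U : Fin n → Ω → F),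
      iIndepFun U ρ → (∀ i, MemLp (U i) 2 ρ) → (∀ i, ∫ ω, U i ω ∂ρ = 0) →
        ∫ ω, ‖∑ i, U i ω‖ ^ 2 ∂ρ ≤ b * ∑ i, ∫ ω, ‖U i ω‖ ^ 2 ∂ρ

/-- `G` is the Gaussian distribution on `F` with mean `a` and covariance `C`. -/
structure IsGaussianWith {F : Type u} [NormedAddCommGroup F] [NormedSpace ℝ F] [MeasurableSpace F]
    (G : Measure F) (a : F) (C : StrongDual ℝ F → StrongDual ℝ F → ℝ) : Prop where
  isGaussian : IsGaussian G
  integrable : Integrable (fun w : F => w) G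
  mean_eq : ∫ w, w ∂G = a
  covariance_eq : ∀ f g : StrongDual ℝ F, cov[fun w => f w, fun w => g w; G] = C f g

section WMW

variable {E : Type u} [NormedAddCommGroup E] [NormedSpace ℝ E]

/-- The Wilcoxon–Mann–Whitney statistic `(mn)⁻¹ ∑ᵢ ∑ⱼ SGN (yⱼ - xᵢ)`. -/
noncomputable def wmwStat {m n : ℕ} (x : Fin m → E) (y : Fin n → E) : StrongDual ℝ E :=
  ((m : ℝ) * (n : ℝ))⁻¹ • ∑ i, ∑ j, SGN (y j - x i)

variable [MeasurableSpace E]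

/-- `E (SGN (Y - X))` for independent `X ∼ P` and `Y ∼ Q`, realized as the two coordinates of the
product space `E × E` with the measure `P ⊗ Q`. -/
noncomputable def wmwMean (P Q : Measure E) : StrongDual ℝ E :=
  ∫ z, SGN (z.2 - z.1) ∂(P.prod Q)

/-- The conditional expectation `E (SGN (Y - X) ∣ X)`, for `X ∼ P` and `Y ∼ Q` the coordinates of
`(E × E, P ⊗ Q)`. -/
noncomputable def condSGNLeft (P Q : Measure E) : E × E → StrongDual ℝ E :=
  (P.prod Q)[fun z => SGN (z.2 - z.1) | MeasurableSpace.comap Prod.fst inferInstance]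

/-- The conditional expectation `E (SGN (Y - X) ∣ Y)`, for `X ∼ P` and `Y ∼ Q` the coordinates of
`(E × E, P ⊗ Q)`. -/
noncomputable def condSGNRight (P Q : Measure E) : E × E → StrongDual ℝ E :=
  (P.prod Q)[fun z => SGN (z.2 - z.1) | MeasurableSpace.comap Prod.snd inferInstance]

/-- The covariance of `E (SGN (Y - X) ∣ X)`. -/
noncomputable def Gamma₁ (P Q : Measure E) (f g : StrongDual ℝ (StrongDual ℝ E)) : ℝ :=
  (∫ z, f (condSGNLeft P Q z) * g (condSGNLeft P Q z) ∂(P.prod Q))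
    - f (wmwMean P Q) * g (wmwMean P Q)

/-- The covariance of `E (SGN (Y - X) ∣ Y)`. -/
noncomputable def Gamma₂ (P Q : Measure E) (f g : StrongDual ℝ (StrongDual ℝ E)) : ℝ :=
  (∫ z, f (condSGNRight P Q z) * g (condSGNRight P Q z) ∂(P.prod Q))
    - f (wmwMean P Q) * g (wmwMean P Q)

end WMW

/-! The kernel `SGN (y - x)` is bounded by 1 because the norm is 1-Lipschitz, so `T_WMW` is a
two-sample U-statistic with a bounded kernel h in a separable space of type 2. Let α(x) and β(y) be
the partial integrals of h, and μ its mean. Hoeffding's decomposition (`sqrt_smul_sub_eq_hoeffding`)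
writes the normalized statistic as √(n/N) times the normalized sum of the α(xᵢ) - μ, plus √(m/N)
times that of the β(yⱼ) - μ, plus a multiple of the double sum of r = h - α - β + μ.

Since r integrates to zero in each variable, type 2 can be used once per sample and bounds the
second moment of its double sum by a multiple of mn
(`IsTypeTwo.exists_integral_norm_sum_sum_sq_le`). After normalization this is O(1/N), so the
remainder vanishes in probability.

Each projection sum obeys a central limit theorem. The scalar theorem gives the marginals. For
tightness, the summand is approximated in L² by a centered one of finite range, whose sums stay in a
finite-dimensional subspace; type 2 controls the error uniformly in the sample size. Independence of
the samples and Slutsky's theorem combine the two limits with weights √(1-γ) and √γ. The covariance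
is identified by computing the conditional expectations as partial integrals. -/

/-! ### Tightness, weak convergence and Gaussian laws -/

/-- A set of measures on a complete metric space is tight if, for every `ε > 0`, there is a compact
set whose closed `ε`-thickening has complement of mass at most `ε` for all of them. -/
lemma isTightMeasureSet_of_forall_cthickening {F : Type*} [MetricSpace F]
    [CompleteSpace F] [MeasurableSpace F] {S : Set (Measure F)}
    (h : ∀ ε : ℝ, 0 < ε → ∃ K : Set F, IsCompact K ∧
      ∀ μ ∈ S, μ (Metric.cthickening ε K)ᶜ ≤ ENNReal.ofReal ε) :
    IsTightMeasureSet S := by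
  rw [isTightMeasureSet_iff_exists_isCompact_measure_compl_le]
  intro ε hε
  -- The intersection of thickenings of radius min(δⱼ, 1/(j+1)) works: summability of δ controls the
  -- lost mass, and 1/(j+1) → 0 forces total boundedness.
  obtain ⟨δ, hδ0, hδ⟩ := ENNReal.exists_pos_sum_of_countable hε.ne' ℕ
  have hη : ∀ j : ℕ, 0 < min (δ j : ℝ) (1 / ((j : ℝ) + 1)) := fun j =>
    lt_min (by exact_mod_cast hδ0 j) (by positivity)
  choose K hK hKS using fun j : ℕ => h _ (hη j)
  refine ⟨⋂ j, Metric.cthickening (min (δ j : ℝ) (1 / ((j : ℝ) + 1))) (K j), ?_, ?_⟩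
  · refine TotallyBounded.isCompact_of_isClosed ?_
      (isClosed_iInter fun j => Metric.isClosed_cthickening)
    rw [Metric.totallyBounded_iff]
    intro η hη0
    obtain ⟨j, hj⟩ := exists_nat_one_div_lt (half_pos hη0)
    obtain ⟨t, ht, htK⟩ := Metric.totallyBounded_iff.1 (hK j).totallyBounded (η / 2) (half_pos hη0)
    refine ⟨t, ht, fun x hx => ?_⟩
    have hx' := Set.mem_iInter.1 hx j
    obtain ⟨y, hy, hxy⟩ := Metric.mem_thickening_iff.1
      (Metric.cthickening_subset_thickening' (half_pos hη0)
        ((min_le_right _ _).trans_lt hj) (K j) hx')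
    obtain ⟨z, hz, hyz⟩ := Set.mem_iUnion₂.1 (htK hy)
    refine Set.mem_iUnion₂.2 ⟨z, hz, ?_⟩
    rw [Metric.mem_ball] at hyz ⊢
    linarith [dist_triangle x y z]
  · intro μ hμ
    rw [Set.compl_iInter]
    calc _ ≤ ∑' j, μ (Metric.cthickening (min (δ j : ℝ) (1 / ((j : ℝ) + 1))) (K j))ᶜ :=
          measure_iUnion_le _
      _ ≤ ∑' j, (δ j : ENNReal) := ENNReal.tsum_le_tsum fun j => (hKS j μ hμ).trans <| by
          rw [← ENNReal.ofReal_coe_nnreal]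
          exact ENNReal.ofReal_le_ofReal (min_le_left _ _)
      _ ≤ ε := hδ.le

/-- A tight sequence of laws whose one-dimensional marginals converge weakly converges weakly. -/
lemma exists_tendsto_of_isTightMeasureSet_of_tendsto_map {F : Type*} [NormedAddCommGroup F]
    [NormedSpace ℝ F] [CompleteSpace F] [SecondCountableTopology F] [MeasurableSpace F]
    [BorelSpace F] (μ : ℕ → ProbabilityMeasure F)
    (ht : IsTightMeasureSet {(μ n : Measure F) | n})
    (ν : StrongDual ℝ F → ProbabilityMeasure ℝ)
    (hν : ∀ L : StrongDual ℝ F,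
      Tendsto (fun n => (μ n).map L.continuous.measurable.aemeasurable) atTop (𝓝 (ν L))) :
    ∃ G : ProbabilityMeasure F,
      (∀ L : StrongDual ℝ F, (G : Measure F).map L = ν L) ∧ Tendsto μ atTop (𝓝 G) := by
  have hcpt : IsCompact (closure {μ n | n}) :=
    isCompact_closure_of_isTightMeasureSet (by simpa using ht)
  -- Prokhorov gives a limit along every ultrafilter. All these limits have the marginals `ν L`,
  -- hence the same characteristic functional, so they coincide.
  have key : ∀ U : Ultrafilter ℕ, (U : Filter ℕ) ≤ atTop → ∃ G : ProbabilityMeasure F,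
      (∀ L : StrongDual ℝ F, (G : Measure F).map L = ν L) ∧ Tendsto μ U (𝓝 G) := by
    intro U hU
    obtain ⟨G, -, hG : Tendsto _ _ _⟩ := hcpt.ultrafilter_le_nhds (U.map μ)
      (.trans (by simp) (monotone_principal subset_closure))
    have hG' : Tendsto μ U (𝓝 G) := hG
    refine ⟨G, fun L => ?_, hG'⟩
    have h1 := ProbabilityMeasure.tendsto_map_of_tendsto_of_continuous _ _ hG' L.continuous
    exact congrArg (fun m : ProbabilityMeasure ℝ => (m : Measure ℝ))
      (tendsto_nhds_unique h1 ((hν L).mono_left hU))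
  obtain ⟨G, hG, -⟩ := key (hyperfilter ℕ) (Nat.hyperfilter_le_atTop)
  refine ⟨G, hG, (tendsto_iff_ultrafilter _ _ _).2 fun U hU => ?_⟩
  obtain ⟨G', hG', h'⟩ := key U hU
  suffices G = G' by rwa [this]
  refine Subtype.ext (?_ : (G : Measure F) = (G' : Measure F))
  apply Measure.ext_of_charFunDual
  ext L
  have := (hG L).trans (hG' L).symm
  rw [charFunDual_eq_charFun_map_one, charFunDual_eq_charFun_map_one]
  exact congrArg (fun m => charFun m 1) this

/-- Chebyshev's inequality for the norm of a random element. -/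
lemma measure_le_norm_le_ofReal {Ω F : Type*} [MeasurableSpace Ω] [NormedAddCommGroup F]
    {μ : Measure Ω} {f : Ω → F}
    (hf : MemLp f 2 μ) {ε C : ℝ} (hε : 0 < ε) (hC : ∫ ω, ‖f ω‖ ^ 2 ∂μ ≤ C) :
    μ {ω | ε ≤ ‖f ω‖} ≤ ENNReal.ofReal (C / ε ^ 2) := by
  have hi : Integrable (fun ω => ‖f ω‖ ^ 2) μ := hf.integrable_norm_pow (by norm_num)
  have h1 := mul_meas_ge_le_lintegral₀ hi.aestronglyMeasurable.aemeasurable.ennreal_ofReal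
    (ENNReal.ofReal (ε ^ 2))
  rw [← ofReal_integral_eq_lintegral_ofReal hi (ae_of_all _ fun _ => by positivity)] at h1
  have hset : {ω | ENNReal.ofReal (ε ^ 2) ≤ ENNReal.ofReal (‖f ω‖ ^ 2)} = {ω | ε ≤ ‖f ω‖} := by
    ext ω
    simp only [Set.mem_ofPred_eq]
    rw [ENNReal.ofReal_le_ofReal_iff (by positivity), sq_le_sq₀ hε.le (norm_nonneg _)]
  rw [hset] at h1
  rw [ENNReal.ofReal_div_of_pos (by positivity), ENNReal.le_div_iff_mul_le (by simp [hε.ne'])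
    (by simp), mul_comm]
  exact h1.trans (ENNReal.ofReal_le_ofReal hC)

/-- A measure with centered Gaussian one-dimensional marginals is Gaussian, and its covariance is
given by polarization. -/
lemma isGaussianWith_zero_of_map_eq {F : Type*} [NormedAddCommGroup F]
    [NormedSpace ℝ F] [CompleteSpace F] [SecondCountableTopology F] [MeasurableSpace F]
    [BorelSpace F] {G : Measure F} {C : StrongDual ℝ F → StrongDual ℝ F → ℝ}
    (hC0 : ∀ f, 0 ≤ C f f) (hC : ∀ f g, C (f + g) (f + g) = C f f + 2 * C f g + C g g)
    (hG : ∀ L : StrongDual ℝ F, G.map L = gaussianReal 0 (C L L).toNNReal) :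
    IsGaussianWith G 0 C := by
  have hgauss : IsGaussian G := isGaussian_of_map_eq_gaussianReal fun L => ⟨_, _, hG L⟩
  have hint : Integrable (fun w : F => w) G := IsGaussian.integrable_id
  have hmean : ∀ L : StrongDual ℝ F, ∫ w, L w ∂G = 0 := fun L => by
    have : ∫ t, t ∂(G.map L) = ∫ w, L w ∂G :=
      integral_map (by fun_prop) (by fun_prop)
    rw [← this, hG L, integral_id_gaussianReal]
  have hvar : ∀ L : StrongDual ℝ F, Var[fun w => L w; G] = C L L := fun L => by
    have : Var[id; G.map L] = Var[L; G] := by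
      rw [variance_map (by fun_prop) (by fun_prop)]; rfl
    rw [← Real.coe_toNNReal _ (hC0 L), ← variance_id_gaussianReal (μ := 0), ← hG L, this]
  refine ⟨hgauss, hint, ?_, fun f g => ?_⟩
  · refine SeparatingDual.eq_zero_of_forall_dual_eq_zero (R := ℝ) fun L => ?_
    rw [← L.integral_comp_comm hint, hmean]
  · have hf := IsGaussian.memLp_dual G f 2 (by simp)
    have hg := IsGaussian.memLp_dual G g 2 (by simp)
    have h1 : Var[fun w => (f + g) w; G] =
        Var[fun w => f w; G] + 2 * cov[fun w => f w, fun w => g w; G] + Var[fun w => g w; G] :=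
      variance_add hf hg
    rw [hvar, hvar, hvar, hC] at h1
    linarith

/-! ### The central limit theorem in type 2 -/

/-- The expectation of a function of one coordinate of an infinite product. -/
lemma integral_comp_eval_infinitePi {E F : Type*} [MeasurableSpace E] [NormedAddCommGroup F]
    [NormedSpace ℝ F] (P : Measure E) [IsProbabilityMeasure P] {g : E → F}
    (hg : AEStronglyMeasurable g P) (i : ℕ) :
    ∫ x, g (x i) ∂(Measure.infinitePi fun _ : ℕ => P) = ∫ x, g x ∂P := by
  have h := (measurePreserving_eval_infinitePi (fun _ : ℕ => P) i).map_eq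
  conv_rhs => rw [← h]
  rw [integral_map (measurable_pi_apply i).aemeasurable (by rwa [h])]

/-- The type 2 inequality for sums of independent copies of a centered random element. -/
lemma IsTypeTwo.exists_integral_norm_sum_sq_le {F : Type u} [NormedAddCommGroup F] [NormedSpace ℝ F]
    [MeasurableSpace F] [BorelSpace F] (h : IsTypeTwo F) :
    ∃ b : ℝ, 0 < b ∧ ∀ (E : Type u) [MeasurableSpace E] (P : Measure E) [IsProbabilityMeasure P]
      (g : E → F), Measurable g → MemLp g 2 P → ∫ x, g x ∂P = 0 → ∀ m : ℕ,
        ∫ x, ‖∑ i ∈ Finset.range m, g (x i)‖ ^ 2 ∂(Measure.infinitePi fun _ : ℕ => P)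
          ≤ b * (m * ∫ x, ‖g x‖ ^ 2 ∂P) := by
  obtain ⟨b, hb, H⟩ := h
  refine ⟨b, hb, fun E _ P _ g hg hg2 hg0 m => ?_⟩
  have hmp : ∀ i : ℕ, MeasurePreserving (fun x : ℕ → E => x i) (Measure.infinitePi fun _ => P) P :=
    fun i => measurePreserving_eval_infinitePi (fun _ => P) i
  have hint := integral_comp_eval_infinitePi P hg2.1
  have hint2 : ∀ i : ℕ, ∫ x, ‖g (x i)‖ ^ 2 ∂(Measure.infinitePi fun _ : ℕ => P)
      = ∫ x, ‖g x‖ ^ 2 ∂P := integral_comp_eval_infinitePi P (hg2.1.norm.pow 2)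
  have := H (ℕ → E) (Measure.infinitePi fun _ => P) m (fun i x => g (x i))
    ((iIndepFun_infinitePi (P := fun _ : ℕ => P) (X := fun _ => g) (fun _ => hg)).precomp
      Fin.val_injective)
    (fun i => hg2.comp_measurePreserving (hmp i)) (fun i => by rw [hint, hg0])
  simp only [hint2, Finset.sum_const, Finset.card_univ, Fintype.card_fin, nsmul_eq_mul] at this
  simpa only [Finset.sum_range] using this

/-- A centered square integrable random element can be approximated in `L²` by centered ones with
finite range. -/
lemma exists_finite_range_integral_norm_sub_sq_lt {E F : Type*} [MeasurableSpace E]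
    [NormedAddCommGroup F] [NormedSpace ℝ F] [CompleteSpace F] [MeasurableSpace F] [BorelSpace F]
    {P : Measure E} [IsProbabilityMeasure P] {a : E → F} (ha : MemLp a 2 P)
    (h0 : ∫ x, a x ∂P = 0) {ε : ℝ} (hε : 0 < ε) :
    ∃ g : E → F, Measurable g ∧ (Set.range g).Finite ∧ MemLp g 2 P ∧ ∫ x, g x ∂P = 0 ∧
      ∫ x, ‖a x - g x‖ ^ 2 ∂P < ε := by
  -- Half of √ε, because centering can double the error: as `a` is centered, the mean c of the
  -- simple function s satisfies ‖c‖ ≤ ‖a - s‖₁ ≤ ‖a - s‖₂.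
  have hη : 0 < √ε / 2 := by positivity
  obtain ⟨s, hs, hs2⟩ := ha.exists_simpleFunc_eLpNorm_sub_lt (by simp)
    (ENNReal.ofReal_pos.2 hη).ne'
  have hsi := hs2.integrable (by norm_num)
  have hai := ha.integrable (by norm_num)
  refine ⟨fun x => s x - ∫ y, s y ∂P, ?_, ?_, hs2.sub (memLp_const _), ?_, ?_⟩
  · exact (s.map fun z => z - ∫ y, s y ∂P).measurable
  · exact (s.map fun z => z - ∫ y, s y ∂P).finite_range
  · rw [integral_sub hsi (integrable_const _)]; simp
  · have hd : MemLp (fun x => a x - s x) 2 P := ha.sub hs2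
    set c : F := ∫ y, s y ∂P with hc
    have hce : c = -∫ x, (a x - s x) ∂P := by
      rw [integral_sub hai hsi, h0]; simp [hc]
    have h1 : eLpNorm (fun x => a x - (s x - c)) 2 P < ENNReal.ofReal (√ε) := by
      have e : (fun x => a x - (s x - c)) = (fun x => a x - s x) + fun _ => c := by
        ext x; simp; abel
      have hcn : eLpNorm (fun _ : E => c) 2 P ≤ eLpNorm (fun x => a x - s x) 2 P := by
        rw [eLpNorm_const' _ (by simp) (by simp)]
        simp only [measure_univ, ENNReal.one_rpow, mul_one]
        calc ‖c‖ₑ ≤ ∫⁻ x, ‖a x - s x‖ₑ ∂P := by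
              rw [hce, enorm_neg]; exact enorm_integral_le_lintegral_enorm _
          _ = eLpNorm (fun x => a x - s x) 1 P := (eLpNorm_one_eq_lintegral_enorm).symm
          _ ≤ _ := eLpNorm_le_eLpNorm_of_exponent_le (by norm_num) hd.1
      rw [e]
      calc _ ≤ _ := eLpNorm_add_le hd.1 aestronglyMeasurable_const (by norm_num)
        _ ≤ eLpNorm (fun x => a x - s x) 2 P + eLpNorm (fun x => a x - s x) 2 P := by gcongr
        _ < ENNReal.ofReal (√ε / 2) + ENNReal.ofReal (√ε / 2) := ENNReal.add_lt_add hs hs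
        _ = _ := by rw [← ENNReal.ofReal_add hη.le hη.le]; ring_nf
    have hm : MemLp (fun x => a x - (s x - c)) 2 P := ha.sub (hs2.sub (memLp_const _))
    rw [hm.eLpNorm_eq_integral_rpow_norm (by simp) (by simp),
      ENNReal.ofReal_lt_ofReal_iff (by positivity)] at h1
    simp only [ENNReal.toReal_ofNat, Real.rpow_ofNat] at h1
    rw [← one_div, ← Real.sqrt_eq_rpow] at h1
    exact (Real.sqrt_lt_sqrt_iff (by positivity)).1 h1

/-- In a space of type 2, the laws of the normalized sums of independent copies of a centered square
integrable random element are tight. -/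
lemma isTightMeasureSet_map_inv_sqrt_smul_sum {E F : Type u} [MeasurableSpace E]
    [NormedAddCommGroup F] [NormedSpace ℝ F] [CompleteSpace F] [SecondCountableTopology F]
    [MeasurableSpace F] [BorelSpace F] (htype : IsTypeTwo F)
    {P : Measure E} [IsProbabilityMeasure P] {a : E → F} (ham : Measurable a) (ha : MemLp a 2 P)
    (h0 : ∫ x, a x ∂P = 0) :
    IsTightMeasureSet (Set.range fun m : ℕ => (Measure.infinitePi fun _ : ℕ => P).map
      fun x => (√(m : ℝ))⁻¹ • ∑ i ∈ Finset.range m, a (x i)) := by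
  obtain ⟨b, hb, H⟩ := htype.exists_integral_norm_sum_sq_le
  have hmp : ∀ i : ℕ, MeasurePreserving (fun x : ℕ → E => x i) (Measure.infinitePi fun _ => P) P :=
    fun i => measurePreserving_eval_infinitePi (fun _ => P) i
  have hmem : ∀ (g : E → F), MemLp g 2 P → ∀ m : ℕ, MemLp (fun x : ℕ → E => (√(m : ℝ))⁻¹ •
      ∑ i ∈ Finset.range m, g (x i)) 2 (Measure.infinitePi fun _ : ℕ => P) := fun g hg m =>
    (memLp_finsetSum _ fun i _ => hg.comp_measurePreserving (hmp i)).const_smul _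
  have hbd : ∀ (g : E → F), Measurable g → MemLp g 2 P → ∫ x, g x ∂P = 0 → ∀ m : ℕ,
      ∫ x, ‖(√(m : ℝ))⁻¹ • ∑ i ∈ Finset.range m, g (x i)‖ ^ 2 ∂(Measure.infinitePi fun _ : ℕ => P)
        ≤ b * ∫ x, ‖g x‖ ^ 2 ∂P := by
    intro g hg hg2 hg0 m
    rcases Nat.eq_zero_or_pos m with rfl | hm
    · simp; positivity
    have hm' : (0 : ℝ) < m := by exact_mod_cast hm
    simp only [norm_smul, mul_pow, norm_inv, Real.norm_of_nonneg (Real.sqrt_nonneg _), inv_pow,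
      Real.sq_sqrt hm'.le]
    rw [integral_const_mul, inv_mul_le_iff₀ hm']
    exact (H E P g hg hg2 hg0 m).trans_eq (by ring)
  refine isTightMeasureSet_of_forall_cthickening fun ε hε => ?_
  -- With this constant, type 2 followed by Chebyshev at level ε bounds the approximation error by b
  -- · (ε³ / 2b) / ε² = ε / 2, for every m.
  obtain ⟨g, hg, hgfin, hg2, hg0, hag⟩ := exists_finite_range_integral_norm_sub_sq_lt ha h0
    (ε := ε ^ 3 / (2 * b)) (by positivity)
  set B := ∫ x, ‖g x‖ ^ 2 ∂P with hB
  have hB0 : 0 ≤ B := integral_nonneg fun x => by positivity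
  obtain ⟨R, hR0, hR⟩ : ∃ R : ℝ, 0 < R ∧ b * B / R ^ 2 ≤ ε / 2 := by
    -- The summand 1 keeps R positive when B = 0.
    refine ⟨√(2 * b * B / ε + 1), by positivity, ?_⟩
    rw [Real.sq_sqrt (by positivity), div_le_iff₀ (by positivity)]
    have : ε / 2 * (2 * b * B / ε + 1) = b * B + ε / 2 := by field_simp
    linarith
  -- All sums of values of g lie in this finite-dimensional space, whose closed balls are compact.
  let V := Submodule.span ℝ (Set.range g)
  have : FiniteDimensional ℝ V := FiniteDimensional.span_of_finite ℝ hgfin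
  refine ⟨V.subtypeL '' Metric.closedBall 0 R,
    (isCompact_closedBall _ _).image V.subtypeL.continuous, ?_⟩
  rintro _ ⟨m, rfl⟩
  rw [Measure.map_apply (by fun_prop) Metric.isClosed_cthickening.measurableSet.compl]
  have hsub : (fun x : ℕ → E => (√(m : ℝ))⁻¹ • ∑ i ∈ Finset.range m, a (x i)) ⁻¹'
      (Metric.cthickening ε (V.subtypeL '' Metric.closedBall 0 R))ᶜ ⊆
      {x | ε ≤ ‖(√(m : ℝ))⁻¹ • ∑ i ∈ Finset.range m, (a (x i) - g (x i))‖} ∪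
      {x | R ≤ ‖(√(m : ℝ))⁻¹ • ∑ i ∈ Finset.range m, g (x i)‖} := by
    intro x hx
    by_contra hcon
    simp only [Set.mem_union, Set.mem_ofPred_eq, not_or, not_le] at hcon
    refine hx ?_
    have hV : (√(m : ℝ))⁻¹ • ∑ i ∈ Finset.range m, g (x i) ∈ V :=
      V.smul_mem _ (V.sum_mem fun i _ => Submodule.subset_span (Set.mem_range_self _))
    refine Metric.mem_cthickening_of_dist_le _ ((√(m : ℝ))⁻¹ • ∑ i ∈ Finset.range m, g (x i)) _ _
      ⟨⟨_, hV⟩, ?_, rfl⟩ ?_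
    · simpa using! hcon.2.le
    · rw [dist_eq_norm]
      simpa [Finset.sum_sub_distrib, smul_sub] using! hcon.1.le
  have hsm := ham.sub hg
  have hai := ha.integrable (by norm_num)
  have hgi := hg2.integrable (by norm_num)
  calc _ ≤ _ := measure_mono hsub
    _ ≤ _ := measure_union_le _ _
    _ ≤ ENNReal.ofReal (b * (ε ^ 3 / (2 * b)) / ε ^ 2) + ENNReal.ofReal (b * B / R ^ 2) := by
      gcongr
      · refine measure_le_norm_le_ofReal (hmem (fun x => a x - g x) (ha.sub hg2) m) hε ?_
        refine (hbd (fun x => a x - g x) hsm (ha.sub hg2) ?_ m).trans (by gcongr)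
        rw [integral_sub hai hgi, h0, hg0, sub_zero]
      · exact measure_le_norm_le_ofReal (hmem g hg2 m) hR0 (hbd g hg hg2 hg0 m)
    _ ≤ ENNReal.ofReal (ε / 2) + ENNReal.ofReal (ε / 2) := by
      refine add_le_add (ENNReal.ofReal_le_ofReal (le_of_eq ?_)) (ENNReal.ofReal_le_ofReal hR)
      field_simp
    _ = ENNReal.ofReal ε := by
      rw [← ENNReal.ofReal_add (by positivity) (by positivity)]; ring_nf

/-- The central limit theorem in a separable Banach space of type 2. -/
theorem IsTypeTwo.exists_tendstoInDistribution_inv_sqrt_smul_sum {E F : Type u} [MeasurableSpace E]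
    [NormedAddCommGroup F] [NormedSpace ℝ F] [CompleteSpace F] [SecondCountableTopology F]
    [MeasurableSpace F] [BorelSpace F] (htype : IsTypeTwo F)
    {P : Measure E} [IsProbabilityMeasure P] {a : E → F} (ham : Measurable a) (ha : MemLp a 2 P)
    (h0 : ∫ x, a x ∂P = 0) :
    ∃ G : ProbabilityMeasure F,
      (∀ L : StrongDual ℝ F,
        (G : Measure F).map L = gaussianReal 0 (∫ x, L (a x) * L (a x) ∂P).toNNReal) ∧
      TendstoInDistribution (fun (m : ℕ) (x : ℕ → E) =>
        (√(m : ℝ))⁻¹ • ∑ i ∈ Finset.range m, a (x i)) atTop id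
        (fun _ => Measure.infinitePi fun _ : ℕ => P) (G : Measure F) := by
  have hmeas : ∀ m : ℕ, AEMeasurable (fun x : ℕ → E => (√(m : ℝ))⁻¹ •
      ∑ i ∈ Finset.range m, a (x i)) (Measure.infinitePi fun _ : ℕ => P) := fun m =>
    Measurable.aemeasurable (by fun_prop)
  have hai := ha.integrable (by norm_num)
  obtain ⟨G, hG, hlim⟩ := exists_tendsto_of_isTightMeasureSet_of_tendsto_map
    (fun m => ⟨_, Measure.isProbabilityMeasure_map (hmeas m)⟩)
    (isTightMeasureSet_map_inv_sqrt_smul_sum htype ham ha h0)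
    (fun L => ⟨gaussianReal 0 (∫ x, L (a x) * L (a x) ∂P).toNNReal, inferInstance⟩) (fun L => by
      have hLa : MemLp (fun x => L (a x)) 2 P := L.comp_memLp' ha
      have hmp : ∀ i : ℕ, MeasurePreserving (fun x : ℕ → E => x i)
          (Measure.infinitePi fun _ => P) P :=
        fun i => measurePreserving_eval_infinitePi (fun _ => P) i
      have hLm : Measurable fun x => L (a x) := by fun_prop
      have hL0 : ∫ x, L (a x) ∂P = 0 := by rw [L.integral_comp_comm hai, h0, map_zero]
      have hmean : ∫ x : ℕ → E, L (a (x 0)) ∂(Measure.infinitePi fun _ => P) = 0 := by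
        rw [← hL0, integral_comp_eval_infinitePi P hLa.1 0]
      have hvar : Var[fun x : ℕ → E => L (a (x 0)); Measure.infinitePi fun _ => P]
          = ∫ x, L (a x) * L (a x) ∂P := by
        rw [variance_of_integral_eq_zero (Measurable.aemeasurable (by fun_prop)) hmean]
        simpa [sq] using integral_comp_eval_infinitePi P (hLa.1.pow 2) 0
      have hY : HasLaw (id : ℝ → ℝ) (gaussianReal 0
          Var[fun x : ℕ → E => L (a (x 0)); Measure.infinitePi fun _ => P].toNNReal)
          (gaussianReal 0 (∫ x, L (a x) * L (a x) ∂P).toNNReal) :=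
        ⟨by fun_prop, by rw [hvar, Measure.map_id]⟩
      have hclt := tendstoInDistribution_inv_sqrt_mul_sum_sub
        (X := fun (i : ℕ) (x : ℕ → E) => L (a (x i))) hY (hLa.comp_measurePreserving (hmp 0))
        (iIndepFun_infinitePi (P := fun _ : ℕ => P) (X := fun _ x => L (a x)) fun _ => hLm)
        (fun i => ⟨Measurable.aemeasurable (by fun_prop), Measurable.aemeasurable (by fun_prop), by
          have h1 := Measure.map_map (μ := Measure.infinitePi fun _ : ℕ => P) hLm
            (measurable_pi_apply i)
          have h2 := Measure.map_map (μ := Measure.infinitePi fun _ : ℕ => P) hLm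
            (measurable_pi_apply 0)
          rw [(hmp i).map_eq] at h1
          rw [(hmp 0).map_eq] at h2
          exact h1.symm.trans h2⟩)
      rw [hmean] at hclt
      have hlim := hclt.tendsto
      simp only [Measure.map_id] at hlim
      refine hlim.congr fun m => Subtype.ext ?_
      change Measure.map _ _ = Measure.map L (Measure.map _ _)
      rw [Measure.map_map (by fun_prop) (by fun_prop)]
      congr 1
      ext x
      simp [map_sum])
  refine ⟨G, hG, hmeas, by fun_prop, ?_⟩
  simp only [Measure.map_id]
  exact hlim

/-! ### Two-sample U-statistics -/

/-- Second moment bound for the sum of a degenerate bounded kernel over two independent samples with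
values in a space of type 2. -/
lemma IsTypeTwo.exists_integral_norm_sum_sum_sq_le {E E' F : Type u} [MeasurableSpace E]
    [MeasurableSpace E'] [NormedAddCommGroup F] [NormedSpace ℝ F] [SecondCountableTopology F]
    [MeasurableSpace F] [BorelSpace F] (htype : IsTypeTwo F)
    {P : Measure E} {Q : Measure E'} [IsProbabilityMeasure P] [IsProbabilityMeasure Q]
    {r : E × E' → F} (hr : Measurable r) {c : ℝ} (hc : ∀ z, ‖r z‖ ≤ c)
    (hP : ∀ y, ∫ x, r (x, y) ∂P = 0) (hQ : ∀ x, ∫ y, r (x, y) ∂Q = 0) :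
    ∃ B : ℝ, ∀ m n : ℕ,
      ∫ z, ‖∑ i ∈ Finset.range m, ∑ j ∈ Finset.range n, r (z.1 i, z.2 j)‖ ^ 2
        ∂((Measure.infinitePi fun _ : ℕ => P).prod (Measure.infinitePi fun _ : ℕ => Q))
        ≤ B * (m * n) := by
  obtain ⟨b, hb, H⟩ := htype.exists_integral_norm_sum_sq_le
  refine ⟨b ^ 2 * c ^ 2, fun m n => ?_⟩
  set π₁ := Measure.infinitePi fun _ : ℕ => P
  set π₂ := Measure.infinitePi fun _ : ℕ => Q
  have hbd1 : ∀ (x : E) (y : ℕ → E'), ‖∑ j ∈ Finset.range n, r (x, y j)‖ ≤ n * c := fun x y => by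
    simpa using norm_sum_le_of_le (Finset.range n) fun j _ => hc (x, y j)
  have hbd2 : ∀ (x : ℕ → E) (y : ℕ → E'),
      ‖∑ i ∈ Finset.range m, ∑ j ∈ Finset.range n, r (x i, y j)‖ ≤ m * (n * c) := fun x y => by
    simpa using norm_sum_le_of_le (Finset.range m) fun i _ => hbd1 (x i) y
  have hi2 : Integrable (fun z : (ℕ → E) × (ℕ → E') =>
      ‖∑ i ∈ Finset.range m, ∑ j ∈ Finset.range n, r (z.1 i, z.2 j)‖ ^ 2) (π₁.prod π₂) :=
    Integrable.of_bound (Measurable.aestronglyMeasurable (by fun_prop)) ((m * (n * c)) ^ 2)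
      (ae_of_all _ fun z => by
        rw [norm_pow, norm_norm]; exact pow_le_pow_left₀ (norm_nonneg _) (hbd2 _ _) 2)
  have hi1 : Integrable (fun z : E × (ℕ → E') =>
      ‖∑ j ∈ Finset.range n, r (z.1, z.2 j)‖ ^ 2) (P.prod π₂) :=
    Integrable.of_bound (Measurable.aestronglyMeasurable (by fun_prop)) ((n * c) ^ 2)
      (ae_of_all _ fun z => by
        rw [norm_pow, norm_norm]; exact pow_le_pow_left₀ (norm_nonneg _) (hbd1 _ _) 2)
  have hrb : ∀ x, ∫ y, ‖r (x, y)‖ ^ 2 ∂Q ≤ c ^ 2 := fun x => by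
    have := integral_mono (μ := Q) (f := fun y => ‖r (x, y)‖ ^ 2) (g := fun _ => c ^ 2)
      (Integrable.of_bound (Measurable.aestronglyMeasurable (by fun_prop)) (c ^ 2)
        (ae_of_all _ fun y => by
          rw [norm_pow, norm_norm]; exact pow_le_pow_left₀ (norm_nonneg _) (hc _) 2))
      (integrable_const _) fun y => pow_le_pow_left₀ (norm_nonneg _) (hc _) 2
    simpa using this
  -- Type 2 in the first sample with the second frozen; the summand x ↦ ∑ⱼ r(x, yⱼ) is centered by
  -- `hP`. Fubini then exchanges the integrals, so that `hright` can use type 2 in the second sample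
  -- with x frozen.
  have hleft : ∀ y : ℕ → E', ∫ x, ‖∑ i ∈ Finset.range m, ∑ j ∈ Finset.range n, r (x i, y j)‖ ^ 2 ∂π₁
      ≤ b * (m * ∫ x, ‖∑ j ∈ Finset.range n, r (x, y j)‖ ^ 2 ∂P) := fun y => by
    have hm : Measurable fun x => ∑ j ∈ Finset.range n, r (x, y j) := by fun_prop
    refine H E P (fun x => ∑ j ∈ Finset.range n, r (x, y j)) hm
      (MemLp.of_bound hm.aestronglyMeasurable _ (ae_of_all _ fun x => hbd1 x y)) ?_ m
    rw [integral_finsetSum _ fun j _ => Integrable.of_bound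
      (Measurable.aestronglyMeasurable (by fun_prop)) c (ae_of_all _ fun x => hc _)]
    simp [hP]
  have hright : ∀ x : E, ∫ y, ‖∑ j ∈ Finset.range n, r (x, y j)‖ ^ 2 ∂π₂ ≤ b * (n * c ^ 2) :=
    fun x => by
      refine (H E' Q (fun y => r (x, y)) (by fun_prop)
        (MemLp.of_bound (Measurable.aestronglyMeasurable (by fun_prop)) c
          (ae_of_all _ fun y => hc _)) (hQ x) n).trans ?_
      have := hrb x
      gcongr
  rw [integral_prod_symm _ hi2]
  calc _ ≤ ∫ y, b * (m * ∫ x, ‖∑ j ∈ Finset.range n, r (x, y j)‖ ^ 2 ∂P) ∂π₂ :=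
        integral_mono hi2.integral_prod_right ((hi1.integral_prod_right.const_mul _).const_mul _)
          hleft
    _ = b * (m * ∫ x, ∫ y, ‖∑ j ∈ Finset.range n, r (x, y j)‖ ^ 2 ∂π₂ ∂P) := by
        rw [integral_const_mul, integral_const_mul]
        congr 2
        exact (integral_integral_swap hi1).symm
    _ ≤ b * (m * ∫ _, b * (n * c ^ 2) ∂P) := by
        refine mul_le_mul_of_nonneg_left (mul_le_mul_of_nonneg_left ?_ m.cast_nonneg) hb.le
        exact integral_mono hi1.integral_prod_left (integrable_const _) hright
    _ = b ^ 2 * c ^ 2 * (m * n) := by simp; ring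

/-- Sequences of random elements on the two factors of a product space which converge in
distribution converge jointly. -/
lemma TendstoInDistribution.prodMap_id {Ω₁ Ω₂ F F' : Type*} [MeasurableSpace Ω₁]
    [MeasurableSpace Ω₂] [TopologicalSpace F] [TopologicalSpace F'] [SecondCountableTopology F]
    [SecondCountableTopology F'] [TopologicalSpace.PseudoMetrizableSpace F]
    [TopologicalSpace.PseudoMetrizableSpace F'] [MeasurableSpace F] [MeasurableSpace F']
    [BorelSpace F] [BorelSpace F'] {μ : Measure Ω₁} {ν : Measure Ω₂} [IsProbabilityMeasure μ]
    [IsProbabilityMeasure ν] {X : ℕ → Ω₁ → F} {Y : ℕ → Ω₂ → F'} {G : ProbabilityMeasure F}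
    {G' : ProbabilityMeasure F'} {l : Filter ℕ} (hXm : ∀ k, Measurable (X k))
    (hYm : ∀ k, Measurable (Y k))
    (hX : TendstoInDistribution X l id (fun _ => μ) (G : Measure F))
    (hY : TendstoInDistribution Y l id (fun _ => ν) (G' : Measure F')) :
    TendstoInDistribution (fun k (z : Ω₁ × Ω₂) => (X k z.1, Y k z.2)) l id (fun _ => μ.prod ν)
      (G.prod G' : Measure (F × F')) := by
  refine ⟨fun k => ((hXm k).prodMap (hYm k)).aemeasurable, by fun_prop, ?_⟩
  have h1 := hX.tendsto
  have h2 := hY.tendsto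
  simp only [Measure.map_id] at h1 h2 ⊢
  refine ((ProbabilityMeasure.continuous_prod.tendsto (G, G')).comp
    (h1.prodMk_nhds h2)).congr fun k => Subtype.ext ?_
  exact Measure.map_prod_map _ _ (hXm k) (hYm k)

/-- A linear combination of independent centered Gaussian variables. -/
lemma map_smul_add_smul_prod_eq_gaussianReal {F : Type*} [NormedAddCommGroup F] [NormedSpace ℝ F]
    [SecondCountableTopology F] [MeasurableSpace F] [BorelSpace F] {G G' : Measure F} [SFinite G]
    [SFinite G'] {s t v w : ℝ} (hs : 0 ≤ s) (ht : 0 ≤ t) (hv : 0 ≤ v) (hw : 0 ≤ w)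
    (L : StrongDual ℝ F)
    (hG : G.map (√s • L) = gaussianReal 0 (s * v).toNNReal)
    (hG' : G'.map (√t • L) = gaussianReal 0 (t * w).toNNReal) :
    ((G.prod G').map fun p => √s • p.1 + √t • p.2).map L
      = gaussianReal 0 (s * v + t * w).toNNReal := by
  have hcomp : (fun p : F × F => L (√s • p.1 + √t • p.2))
      = (fun q : ℝ × ℝ => q.1 + q.2) ∘ Prod.map (√s • L : StrongDual ℝ F) (√t • L) := by
    ext p; simp
  rw [Measure.map_map (by fun_prop) (by fun_prop), Function.comp_def, hcomp,
    ← Measure.map_map (by fun_prop) (by fun_prop),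
    ← Measure.map_prod_map _ _ (by fun_prop) (by fun_prop), hG, hG',
    Real.toNNReal_add (by positivity) (by positivity)]
  simpa [Measure.conv] using gaussianReal_conv_gaussianReal (m₁ := 0) (m₂ := 0)
    (v₁ := (s * v).toNNReal) (v₂ := (t * w).toNNReal)

/-- The Hoeffding decomposition of a normalized two-sample sum. -/
lemma sqrt_smul_sub_eq_hoeffding {F : Type*} [NormedAddCommGroup F] [NormedSpace ℝ F]
    {m n : ℕ} (hm : 0 < m) (hn : 0 < n) (h : ℕ → ℕ → F) (a b : ℕ → F) (μ : F) :
    √((m : ℝ) * n / (m + n)) •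
        (((m : ℝ) * n)⁻¹ • ∑ i ∈ Finset.range m, ∑ j ∈ Finset.range n, h i j - μ)
      - (√((n : ℝ) / (m + n)) • (√(m : ℝ))⁻¹ • ∑ i ∈ Finset.range m, (a i - μ)
        + √((m : ℝ) / (m + n)) • (√(n : ℝ))⁻¹ • ∑ j ∈ Finset.range n, (b j - μ))
      = (√((m : ℝ) * n / (m + n)) * ((m : ℝ) * n)⁻¹) •
        ∑ i ∈ Finset.range m, ∑ j ∈ Finset.range n, (h i j - a i - b j + μ) := by
  have hm' : (0 : ℝ) < m := by exact_mod_cast hm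
  have hn' : (0 : ℝ) < n := by exact_mod_cast hn
  have e1 : √((n : ℝ) / (m + n)) * (√(m : ℝ))⁻¹ = √((m : ℝ) * n / (m + n)) * (m : ℝ)⁻¹ := by
    rw [mul_div_assoc, Real.sqrt_mul hm'.le]
    have := Real.sq_sqrt hm'.le
    have h0 := Real.sqrt_pos.2 hm'
    field_simp
    rw [this]
  have e2 : √((m : ℝ) / (m + n)) * (√(n : ℝ))⁻¹ = √((m : ℝ) * n / (m + n)) * (n : ℝ)⁻¹ := by
    rw [mul_comm (m : ℝ) n, mul_div_assoc, Real.sqrt_mul hn'.le]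
    have := Real.sq_sqrt hn'.le
    have h0 := Real.sqrt_pos.2 hn'
    field_simp
    rw [this]
  rw [smul_smul, smul_smul, e1, e2]
  -- All square roots now share this factor, and the rest is linear algebra.
  generalize √((m : ℝ) * n / (m + n)) = s
  simp only [Finset.sum_sub_distrib, Finset.sum_add_distrib, Finset.sum_const, Finset.card_range,
    ← Finset.smul_sum, ← Nat.cast_smul_eq_nsmul ℝ]
  match_scalars <;> field_simp
  ring

/-- Polarization for the second moments of a square integrable random element. -/
lemma integral_add_dual_mul_add_dual {Ω F : Type*} [MeasurableSpace Ω] [NormedAddCommGroup F]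
    [NormedSpace ℝ F] {ν : Measure Ω} {V : Ω → F} (hV : MemLp V 2 ν) (f g : StrongDual ℝ F) :
    ∫ ω, (f + g) (V ω) * (f + g) (V ω) ∂ν = ∫ ω, f (V ω) * f (V ω) ∂ν
      + 2 * ∫ ω, f (V ω) * g (V ω) ∂ν + ∫ ω, g (V ω) * g (V ω) ∂ν := by
  have hi : ∀ f g : StrongDual ℝ F, Integrable (fun ω => f (V ω) * g (V ω)) ν :=
    fun f g => (f.comp_memLp' hV).integrable_mul (g.comp_memLp' hV)
  have hfg : Integrable (fun ω => 2 * (f (V ω) * g (V ω))) ν := (hi f g).const_mul 2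
  have hff : Integrable (fun ω => f (V ω) * f (V ω) + 2 * (f (V ω) * g (V ω))) ν :=
    (hi f f).add hfg
  rw [← integral_const_mul, ← integral_add (hi f f) hfg, ← integral_add hff (hi g g)]
  congr 1 with ω
  simp only [add_apply]
  ring

/-- The central limit theorem for two-sample U-statistics with a bounded kernel with values in a
separable Banach space of type 2. -/
theorem IsTypeTwo.exists_tendstoInDistribution_twoSample {E E' F : Type u} [MeasurableSpace E]
    [MeasurableSpace E'] [NormedAddCommGroup F] [NormedSpace ℝ F] [CompleteSpace F]
    [SecondCountableTopology F] [MeasurableSpace F] [BorelSpace F] (htype : IsTypeTwo F)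
    (P : Measure E) (Q : Measure E') [IsProbabilityMeasure P] [IsProbabilityMeasure Q]
    {h : E × E' → F} (hh : Measurable h) {c : ℝ} (hc : ∀ z, ‖h z‖ ≤ c)
    (m n : ℕ → ℕ) {γ : ℝ} (hγ : γ ∈ Set.Icc (0 : ℝ) 1)
    (hm : Tendsto m atTop atTop) (hn : Tendsto n atTop atTop)
    (hmn : Tendsto (fun k => (m k : ℝ) / ((m k : ℝ) + (n k : ℝ))) atTop (𝓝 γ)) :
    ∃ G : ProbabilityMeasure F,
      IsGaussianWith (G : Measure F) 0 (fun f g =>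
        (1 - γ) * ∫ x, f ((∫ y, h (x, y) ∂Q) - ∫ z, h z ∂(P.prod Q)) *
          g ((∫ y, h (x, y) ∂Q) - ∫ z, h z ∂(P.prod Q)) ∂P
        + γ * ∫ y, f ((∫ x, h (x, y) ∂P) - ∫ z, h z ∂(P.prod Q)) *
          g ((∫ x, h (x, y) ∂P) - ∫ z, h z ∂(P.prod Q)) ∂Q) ∧
      TendstoInDistribution
        (fun k (z : (ℕ → E) × (ℕ → E')) =>
          √((m k : ℝ) * (n k : ℝ) / ((m k : ℝ) + (n k : ℝ))) •
          (((m k : ℝ) * (n k : ℝ))⁻¹ • ∑ i ∈ Finset.range (m k), ∑ j ∈ Finset.range (n k),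
            h (z.1 i, z.2 j) - ∫ z, h z ∂(P.prod Q)))
        atTop id
        (fun _ => (Measure.infinitePi fun _ : ℕ => P).prod (Measure.infinitePi fun _ : ℕ => Q))
        (G : Measure F) := by
  set μ := ∫ z, h z ∂(P.prod Q) with hμ
  set α : E → F := fun x => ∫ y, h (x, y) ∂Q with hα
  set β : E' → F := fun y => ∫ x, h (x, y) ∂P with hβ
  have hhi : Integrable h (P.prod Q) :=
    Integrable.of_bound hh.aestronglyMeasurable c (ae_of_all _ hc)
  have hhx : ∀ x, Integrable (fun y => h (x, y)) Q := fun x =>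
    Integrable.of_bound (Measurable.aestronglyMeasurable (by fun_prop)) c (ae_of_all _ fun y => hc _)
  have hhy : ∀ y, Integrable (fun x => h (x, y)) P := fun y =>
    Integrable.of_bound (Measurable.aestronglyMeasurable (by fun_prop)) c (ae_of_all _ fun y => hc _)
  have hαm : Measurable α := (hh.stronglyMeasurable.integral_prod_right' (ν := Q)).measurable
  have hβm : Measurable β := (hh.stronglyMeasurable.integral_prod_left' (μ := P)).measurable
  have hαc : ∀ x, ‖α x‖ ≤ c := fun x => by
    simpa using norm_integral_le_of_norm_le_const (μ := Q) (ae_of_all _ fun y => hc (x, y))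
  have hβc : ∀ y, ‖β y‖ ≤ c := fun y => by
    simpa using norm_integral_le_of_norm_le_const (μ := P) (ae_of_all _ fun x => hc (x, y))
  have hμc : ‖μ‖ ≤ c := by
    simpa using norm_integral_le_of_norm_le_const (μ := P.prod Q) (ae_of_all _ hc)
  have hα2 : MemLp α 2 P := MemLp.of_bound hαm.aestronglyMeasurable c (ae_of_all _ hαc)
  have hβ2 : MemLp β 2 Q := MemLp.of_bound hβm.aestronglyMeasurable c (ae_of_all _ hβc)
  have hαi : Integrable α P := hα2.integrable (by norm_num)
  have hβi : Integrable β Q := hβ2.integrable (by norm_num)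
  have hαμ : ∫ x, α x ∂P = μ := (integral_prod h hhi).symm
  have hβμ : ∫ y, β y ∂Q = μ := (integral_prod_symm h hhi).symm
  have hα2' : MemLp (fun x => α x - μ) 2 P := hα2.sub (memLp_const μ)
  have hβ2' : MemLp (fun y => β y - μ) 2 Q := hβ2.sub (memLp_const μ)
  obtain ⟨Ga, hGa, hA⟩ := htype.exists_tendstoInDistribution_inv_sqrt_smul_sum (P := P)
    (a := fun x => α x - μ) (by fun_prop) hα2'
    (by rw [integral_sub hαi (integrable_const _), hαμ]; simp)
  obtain ⟨Gb, hGb, hB⟩ := htype.exists_tendstoInDistribution_inv_sqrt_smul_sum (P := Q)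
    (a := fun y => β y - μ) (by fun_prop) hβ2'
    (by rw [integral_sub hβi (integrable_const _), hβμ]; simp)
  have hrc : ∀ x y, ‖h (x, y) - α x - β y + μ‖ ≤ c + c + c + c := fun x y => by
    have h1 := norm_add_le (h (x, y) - α x - β y) μ
    have h2 := norm_sub_le (h (x, y) - α x) (β y)
    have h3 := norm_sub_le (h (x, y)) (α x)
    linarith [hc (x, y), hαc x, hβc y]
  obtain ⟨C, hC⟩ := htype.exists_integral_norm_sum_sum_sq_le (P := P) (Q := Q)
    (r := fun z => h z - α z.1 - β z.2 + μ) (by fun_prop) (c := c + c + c + c)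
    (fun z => hrc z.1 z.2)
    (fun y => by
      have h1 : Integrable (fun x => h (x, y) - α x) P := (hhy y).sub hαi
      have h2 : Integrable (fun x => h (x, y) - α x - β y) P := h1.sub (integrable_const _)
      rw [integral_add h2 (integrable_const _), integral_sub h1 (integrable_const _),
        integral_sub (hhy y) hαi, hαμ]
      simp [hβ])
    (fun x => by
      have h1 : Integrable (fun y => h (x, y) - α x) Q := (hhx x).sub (integrable_const _)
      have h2 : Integrable (fun y => h (x, y) - α x - β y) Q := h1.sub hβi
      rw [integral_add h2 (integrable_const _), integral_sub h1 hβi,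
        integral_sub (hhx x) (integrable_const _), hβμ]
      simp [hα])
  have hγ1 : 0 ≤ 1 - γ := sub_nonneg.2 hγ.2
  have hγ0 : 0 ≤ γ := hγ.1
  have hgm : Measurable fun p : F × F => √(1 - γ) • p.1 + √γ • p.2 := by fun_prop
  refine ⟨(Ga.prod Gb).map hgm.aemeasurable, ?_, ?_⟩
  · have hpos : ∀ f : StrongDual ℝ F, 0 ≤ ∫ x, f (α x - μ) * f (α x - μ) ∂P := fun f =>
      integral_nonneg fun x => mul_self_nonneg _
    have hpos' : ∀ f : StrongDual ℝ F, 0 ≤ ∫ y, f (β y - μ) * f (β y - μ) ∂Q := fun f =>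
      integral_nonneg fun x => mul_self_nonneg _
    refine isGaussianWith_zero_of_map_eq (fun f => ?_) (fun f g => ?_) (fun L => ?_)
    · have := hpos f
      have := hpos' f
      positivity
    · have e1 := integral_add_dual_mul_add_dual hα2' f g
      have e2 := integral_add_dual_mul_add_dual hβ2' f g
      linear_combination (1 - γ) * e1 + γ * e2
    · refine map_smul_add_smul_prod_eq_gaussianReal hγ1 hγ0 (hpos L) (hpos' L) L ?_ ?_
      · rw [hGa, ← integral_const_mul]
        congr 3; ext x
        simp only [smul_apply, smul_eq_mul]
        linear_combination (L (α x - μ)) ^ 2 * Real.mul_self_sqrt hγ1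
      · rw [hGb, ← integral_const_mul]
        congr 3; ext x
        simp only [smul_apply, smul_eq_mul]
        linear_combination (L (β x - μ)) ^ 2 * Real.mul_self_sqrt hγ0
  · have hjoint := TendstoInDistribution.prodMap_id
      (X := fun k (x : ℕ → E) => (√(m k : ℝ))⁻¹ • ∑ i ∈ Finset.range (m k), (α (x i) - μ))
      (Y := fun k (y : ℕ → E') => (√(n k : ℝ))⁻¹ • ∑ j ∈ Finset.range (n k), (β (y j) - μ))
      (l := atTop) (fun k => by fun_prop) (fun k => by fun_prop)
      ⟨fun k => hA.forall_aemeasurable (m k), by fun_prop, hA.tendsto.comp hm⟩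
      ⟨fun k => hB.forall_aemeasurable (n k), by fun_prop, hB.tendsto.comp hn⟩
    have hpos : ∀ᶠ k in atTop, 0 < m k ∧ 0 < n k :=
      (hm.eventually_gt_atTop 0).and (hn.eventually_gt_atTop 0)
    -- The identity n/N = 1 - m/N fails at m = n = 0, where both quotients are 0, hence only an
    -- eventual equality.
    have hnm : Tendsto (fun k => (n k : ℝ) / ((m k : ℝ) + (n k : ℝ))) atTop (𝓝 (1 - γ)) := by
      refine (hmn.const_sub 1).congr' ?_
      filter_upwards [hpos] with k hk
      have : (0 : ℝ) < m k := by exact_mod_cast hk.1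
      field_simp
      ring
    have hcoef : Tendsto (fun k => (√((n k : ℝ) / ((m k : ℝ) + (n k : ℝ))),
        √((m k : ℝ) / ((m k : ℝ) + (n k : ℝ))))) atTop (𝓝 (√(1 - γ), √γ)) :=
      ((Real.continuous_sqrt.tendsto _).comp hnm).prodMk_nhds
        ((Real.continuous_sqrt.tendsto _).comp hmn)
    have hslut := hjoint.continuous_comp_prodMk_of_tendstoInMeasure_const
      (g := fun p : (F × F) × (ℝ × ℝ) => p.2.1 • p.1.1 + p.2.2 • p.1.2) (by fun_prop)
      (Y := fun k _ => (√((n k : ℝ) / ((m k : ℝ) + (n k : ℝ))),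
        √((m k : ℝ) / ((m k : ℝ) + (n k : ℝ))))) (c := (√(1 - γ), √γ))
      (tendstoInMeasure_of_tendsto_ae (fun k => aestronglyMeasurable_const)
        (ae_of_all _ fun _ => hcoef)) (fun k => by fun_prop)
    have hlim : TendstoInDistribution (fun k (z : (ℕ → E) × (ℕ → E')) =>
        √((n k : ℝ) / ((m k : ℝ) + (n k : ℝ))) •
          (√(m k : ℝ))⁻¹ • ∑ i ∈ Finset.range (m k), (α (z.1 i) - μ)
        + √((m k : ℝ) / ((m k : ℝ) + (n k : ℝ))) •
          (√(n k : ℝ))⁻¹ • ∑ j ∈ Finset.range (n k), (β (z.2 j) - μ)) atTop id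
        (fun _ => (Measure.infinitePi fun _ : ℕ => P).prod (Measure.infinitePi fun _ : ℕ => Q))
        ((Ga.prod Gb).map hgm.aemeasurable : Measure F) := by
      refine ⟨hslut.forall_aemeasurable, by fun_prop, ?_⟩
      simp only [Measure.map_id]
      exact hslut.tendsto
    refine tendstoInDistribution_of_tendstoInMeasure_sub _ _ hlim ?_
      fun k => Measurable.aemeasurable (by fun_prop)
    rw [tendstoInMeasure_iff_norm]
    intro ε hε
    -- The remainder has second moment at most (mn/N)(mn)⁻² · |C|mn = |C|/N ≤ |C|/m. The absolute
    -- value is there because the sign of C is unknown.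
    have hz : Tendsto (fun k => ENNReal.ofReal (|C| / m k / ε ^ 2)) atTop (𝓝 0) := by
      have h0 : Tendsto (fun k => |C| / m k / ε ^ 2) atTop (𝓝 0) := by
        have := ((tendsto_natCast_atTop_atTop (R := ℝ)).comp hm).const_div_atTop |C|
        simpa using this.div_const (ε ^ 2)
      simpa using ENNReal.tendsto_ofReal h0
    refine tendsto_of_tendsto_of_tendsto_of_le_of_le' tendsto_const_nhds hz
      (Eventually.of_forall fun _ => zero_le) ?_
    filter_upwards [hpos] with k hk
    have hm0 : (0 : ℝ) < m k := by exact_mod_cast hk.1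
    have hn0 : (0 : ℝ) < n k := by exact_mod_cast hk.2
    simp only [Pi.sub_apply, Pi.zero_apply, sub_zero]
    simp only [fun z : (ℕ → E) × (ℕ → E') => sqrt_smul_sub_eq_hoeffding hk.1 hk.2
      (fun i j => h (z.1 i, z.2 j)) (fun i => α (z.1 i)) (fun j => β (z.2 j)) μ]
    refine measure_le_norm_le_ofReal (MemLp.of_bound (Measurable.aestronglyMeasurable
      (by fun_prop)) (‖√((m k : ℝ) * n k / (m k + n k)) * ((m k : ℝ) * n k)⁻¹‖ *
        (m k * (n k * (c + c + c + c)))) (ae_of_all _ fun z => ?_)) hε ?_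
    · rw [norm_smul]
      refine mul_le_mul_of_nonneg_left ?_ (norm_nonneg _)
      have h1 : ∀ i ∈ Finset.range (m k), ‖∑ j ∈ Finset.range (n k),
          (h (z.1 i, z.2 j) - α (z.1 i) - β (z.2 j) + μ)‖ ≤ n k * (c + c + c + c) := fun i _ => by
        simpa [mul_add] using norm_sum_le_of_le (Finset.range (n k)) fun j _ =>
          hrc (z.1 i) (z.2 j)
      simpa using norm_sum_le_of_le (Finset.range (m k)) h1
    · simp only [norm_smul, mul_pow, Real.norm_eq_abs, sq_abs]
      rw [integral_const_mul, Real.sq_sqrt (by positivity)]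
      calc _ ≤ ((m k : ℝ) * n k / (m k + n k)) * (((m k : ℝ) * n k)⁻¹) ^ 2
              * (|C| * (m k * n k)) := by
            refine mul_le_mul_of_nonneg_left ((hC (m k) (n k)).trans ?_) (by positivity)
            exact mul_le_mul_of_nonneg_right (le_abs_self C) (by positivity)
        _ = |C| / (m k + n k) := by field_simp
        _ ≤ |C| / m k := by gcongr; linarith

/-! ### Separability and measurability in the dual -/

/-- A normed space with a separable dual is separable. -/
lemma separableSpace_of_separableSpace_strongDual (E : Type*) [NormedAddCommGroup E]
    [NormedSpace ℝ E] [TopologicalSpace.SeparableSpace (StrongDual ℝ E)] :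
    TopologicalSpace.SeparableSpace E := by
  obtain ⟨e, he⟩ := TopologicalSpace.exists_dense_seq (StrongDual ℝ E)
  have hx : ∀ n, ∃ x : E, ‖x‖ ≤ 1 ∧ ‖e n‖ / 2 ≤ ‖e n x‖ := fun n => by
    rcases (norm_nonneg (e n)).eq_or_lt with h0 | h0
    · exact ⟨0, by simp, by simp [← h0]⟩
    · obtain ⟨x, hx, hx'⟩ := (e n).exists_lt_apply_of_lt_opNorm (half_lt_self h0)
      exact ⟨x, hx.le, hx'.le⟩
  choose x hx1 hx2 using hx
  set V := (Submodule.span ℝ (Set.range x)).topologicalClosure with hV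
  have hVc : IsClosed (V : Set E) := Submodule.isClosed_topologicalClosure _
  have htop : V = ⊤ := by
    by_contra hne
    obtain ⟨y, hy⟩ : ∃ y, y ∉ V := by
      by_contra! hall
      exact hne (Submodule.eq_top_iff'.2 hall)
    obtain ⟨g, u, hgu, hug⟩ := geometric_hahn_banach_closed_point V.convex hVc hy
    -- A functional bounded above by u on a subspace vanishes there: otherwise rescaling z makes it
    -- take the value u, against the strict bound.
    have hgV : ∀ z ∈ V, g z = 0 := fun z hz => by
      by_contra h0
      have := hgu _ (V.smul_mem (u / g z) hz)
      simp [h0] at this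
    have hg0 : g ≠ 0 := by
      rintro rfl
      have := hgu 0 V.zero_mem
      simp at this hug
      linarith
    have hgn : 0 < ‖g‖ := norm_pos_iff.2 hg0
    -- Within ‖g‖/4 of g, ‖e n‖ exceeds 3‖g‖/4; but g vanishes at `x n`, so ‖e n‖/2 ≤ ‖g - e n‖ <
    -- ‖g‖/4, a contradiction.
    obtain ⟨n, hn⟩ := he.exists_dist_lt g (show 0 < ‖g‖ / 4 by positivity)
    rw [dist_eq_norm] at hn
    have hgx : g (x n) = 0 :=
      hgV _ (Submodule.le_topologicalClosure _ (Submodule.subset_span (Set.mem_range_self n)))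
    have h1 : ‖e n (x n)‖ ≤ ‖g - e n‖ := by
      have := (g - e n).le_of_opNorm_le_of_le le_rfl (hx1 n)
      simpa [hgx] using this
    have h2 : ‖g‖ - ‖e n‖ ≤ ‖g - e n‖ := norm_sub_norm_le _ _
    linarith [hx2 n]
  have hsep : TopologicalSpace.IsSeparable (V : Set E) := by
    rw [hV, Submodule.topologicalClosure_coe]
    exact ((Set.countable_range x).isSeparable.span).closure
  rw [htop] at hsep
  exact TopologicalSpace.isSeparable_univ_iff.1 (by simpa using hsep)

/-- A map into a separable dual space is measurable if its evaluations are. -/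
lemma measurable_strongDual_of_forall_apply {Ω E : Type*} [MeasurableSpace Ω]
    [NormedAddCommGroup E] [NormedSpace ℝ E] [TopologicalSpace.SeparableSpace (StrongDual ℝ E)]
    {φ : Ω → StrongDual ℝ E} (hφ : ∀ h : E, Measurable fun ω => φ ω h) : Measurable φ := by
  have := separableSpace_of_separableSpace_strongDual E
  obtain ⟨d, hd⟩ := TopologicalSpace.exists_dense_seq E
  obtain ⟨e, he⟩ := TopologicalSpace.exists_dense_seq (StrongDual ℝ E)
  -- The operator norm is tested on a dense sequence of E, so this preimage is a countable
  -- intersection. Separability of the dual then covers open sets by countably many such balls.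
  have hball : ∀ (L : StrongDual ℝ E) (r : ℝ), MeasurableSet (φ ⁻¹' Metric.closedBall L r) := by
    intro L r
    rcases lt_or_ge r 0 with hr | hr
    · simp [Metric.closedBall_eq_empty.2 hr]
    have : φ ⁻¹' Metric.closedBall L r = ⋂ n, {ω | ‖φ ω (d n) - L (d n)‖ ≤ r * ‖d n‖} := by
      ext ω
      simp only [Set.mem_preimage, Metric.mem_closedBall, dist_eq_norm, Set.mem_iInter,
        Set.mem_ofPred_eq]
      refine ⟨fun h n => (φ ω - L).le_of_opNorm_le h (d n), fun h => ?_⟩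
      refine ContinuousLinearMap.opNorm_le_bound _ hr fun x => ?_
      exact hd.induction_on (p := fun x => ‖(φ ω - L) x‖ ≤ r * ‖x‖) x
        (isClosed_le (by fun_prop) (by fun_prop)) h
    rw [this]
    exact MeasurableSet.iInter fun n =>
      measurableSet_le (((hφ _).sub_const _).norm) measurable_const
  refine measurable_of_isOpen fun s hs => ?_
  have hcov : s = ⋃ p : {p : ℕ × ℚ // Metric.closedBall (e p.1) p.2 ⊆ s},
      Metric.closedBall (e p.1.1) p.1.2 := by
    refine Set.Subset.antisymm (fun L hL => ?_) (Set.iUnion_subset fun p => p.2)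
    obtain ⟨ε, hε, hεs⟩ := Metric.isOpen_iff.1 hs L hL
    obtain ⟨q, hq0, hq⟩ := exists_rat_btwn (show (0 : ℝ) < ε / 2 by positivity)
    obtain ⟨n, hn⟩ := he.exists_dist_lt L hq0
    refine Set.mem_iUnion.2 ⟨⟨(n, q), fun M hM => hεs ?_⟩, hn.le⟩
    rw [Metric.mem_closedBall] at hM
    rw [Metric.mem_ball]
    have := dist_triangle_right M L (e n)
    linarith
  rw [hcov, Set.preimage_iUnion]
  exact MeasurableSet.iUnion fun p => hball _ _

/-! ### The spatial sign -/

section SGN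

variable {E : Type*} [NormedAddCommGroup E] [NormedSpace ℝ E]

lemma SGN_zero : SGN (0 : E) = 0 := by simp [SGN]

lemma IsSmoothSpace.isGateauxDerivNorm_SGN (h : IsSmoothSpace E) {x : E} (hx : x ≠ 0) :
    IsGateauxDerivNorm (SGN x) x := by
  have hx' : x ≠ 0 ∧ ∃ L : StrongDual ℝ E, IsGateauxDerivNorm L x := ⟨hx, h x hx⟩
  rw [SGN, dif_pos hx']
  exact hx'.2.choose_spec

lemma IsSmoothSpace.norm_SGN_le_one (h : IsSmoothSpace E) (x : E) : ‖SGN x‖ ≤ 1 := by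
  rcases eq_or_ne x 0 with rfl | hx
  · simp [SGN_zero]
  · refine ContinuousLinearMap.opNorm_le_bound _ zero_le_one fun v => ?_
    simpa using (h.isGateauxDerivNorm_SGN hx v).le_of_lipschitz lipschitzWith_one_norm

/-- Each evaluation at v is a pointwise limit of continuous difference quotients. The indicator
removes the origin, where they would give ‖v‖ instead of 0. -/
lemma IsSmoothSpace.measurable_SGN [MeasurableSpace E] [BorelSpace E]
    [TopologicalSpace.SeparableSpace (StrongDual ℝ E)] (h : IsSmoothSpace E) :
    Measurable (SGN : E → StrongDual ℝ E) := by
  refine measurable_strongDual_of_forall_apply fun v => ?_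
  refine measurable_of_tendsto_metrizable (f := fun (n : ℕ) (x : E) =>
    ({0}ᶜ : Set E).indicator (fun x => ((n : ℝ) + 1) * (‖x + (1 / ((n : ℝ) + 1)) • v‖ - ‖x‖)) x)
    (fun n => Measurable.indicator (Continuous.measurable (by fun_prop))
      (measurableSet_singleton 0).compl) ?_
  rw [tendsto_pi_nhds]
  intro x
  rcases eq_or_ne x 0 with rfl | hx
  · simp [SGN_zero]
  · have hseq : Tendsto (fun n : ℕ => 1 / ((n : ℝ) + 1)) atTop (𝓝[≠] 0) :=
      tendsto_nhdsWithin_iff.2 ⟨tendsto_one_div_add_atTop_nhds_zero_nat,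
        Eventually.of_forall fun n => by simp; positivity⟩
    have := (h.isGateauxDerivNorm_SGN hx v).tendsto_slope_zero.comp hseq
    refine this.congr fun n => ?_
    simp [hx]

end SGN

/-! ### Conditional expectations, covariances and sample laws -/

/-- Conditional expectation given the first coordinate of a product space. -/
lemma condExp_comap_fst_ae_eq {E E' F : Type*} [MeasurableSpace E] [MeasurableSpace E']
    [NormedAddCommGroup F] [NormedSpace ℝ F] [CompleteSpace F] {P : Measure E} {Q : Measure E'}
    [IsProbabilityMeasure P] [IsProbabilityMeasure Q] {h : E × E' → F}
    (hh : StronglyMeasurable h) (hi : Integrable h (P.prod Q)) :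
    (P.prod Q)[h | MeasurableSpace.comap Prod.fst inferInstance]
      =ᵐ[P.prod Q] fun z => ∫ y, h (z.1, y) ∂Q := by
  have hsm : StronglyMeasurable fun x => ∫ y, h (x, y) ∂Q := hh.integral_prod_right'
  have hint : Integrable (fun x => ∫ y, h (x, y) ∂Q) P := hi.integral_prod_left
  refine (ae_eq_condExp_of_forall_setIntegral_eq measurable_fst.comap_le hi (fun s _ _ => ?_)
    (fun s hs _ => ?_) ?_).symm
  · exact (hint.comp_fst Q).integrableOn
  · obtain ⟨t, ht, rfl⟩ := hs
    have hst : (Prod.fst ⁻¹' t : Set (E × E')) = t ×ˢ Set.univ := by ext; simp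
    rw [hst, setIntegral_prod _ (by rw [← hst]; exact (hint.comp_fst Q).integrableOn),
      setIntegral_prod _ hi.integrableOn]
    simp
  · exact (hsm.comp_measurable (comap_measurable Prod.fst)).aestronglyMeasurable

/-- Conditional expectation given the second coordinate of a product space. -/
lemma condExp_comap_snd_ae_eq {E E' F : Type*} [MeasurableSpace E] [MeasurableSpace E']
    [NormedAddCommGroup F] [NormedSpace ℝ F] [CompleteSpace F] {P : Measure E} {Q : Measure E'}
    [IsProbabilityMeasure P] [IsProbabilityMeasure Q] {h : E × E' → F}
    (hh : StronglyMeasurable h) (hi : Integrable h (P.prod Q)) :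
    (P.prod Q)[h | MeasurableSpace.comap Prod.snd inferInstance]
      =ᵐ[P.prod Q] fun z => ∫ x, h (x, z.2) ∂P := by
  have hsm : StronglyMeasurable fun y => ∫ x, h (x, y) ∂P := hh.integral_prod_left'
  have hint : Integrable (fun y => ∫ x, h (x, y) ∂P) Q := hi.integral_prod_right
  refine (ae_eq_condExp_of_forall_setIntegral_eq measurable_snd.comap_le hi (fun s _ _ => ?_)
    (fun s hs _ => ?_) ?_).symm
  · exact (hint.comp_snd P).integrableOn
  · obtain ⟨t, ht, rfl⟩ := hs
    have hst : (Prod.snd ⁻¹' t : Set (E × E')) = Set.univ ×ˢ t := by ext; simp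
    have hi' := hi.integrableOn (s := Set.univ ×ˢ t)
    rw [IntegrableOn, ← Measure.prod_restrict, Measure.restrict_univ] at hi'
    rw [hst, setIntegral_prod _ (by rw [← hst]; exact (hint.comp_snd P).integrableOn),
      Measure.restrict_univ]
    simp only [integral_const, probReal_univ, one_smul]
    rw [← Measure.prod_restrict, Measure.restrict_univ, integral_prod_symm _ hi']
  · exact (hsm.comp_measurable (comap_measurable Prod.snd)).aestronglyMeasurable

/-- The centered second moments of a random element with mean `μ`. -/
lemma integral_dual_sub_mul_dual_sub {Ω F : Type*} [MeasurableSpace Ω] [NormedAddCommGroup F]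
    [NormedSpace ℝ F] [CompleteSpace F] {ν : Measure Ω} [IsProbabilityMeasure ν] {V : Ω → F}
    (hV : MemLp V 2 ν) {μ : F} (hμ : ∫ ω, V ω ∂ν = μ) (f g : StrongDual ℝ F) :
    ∫ ω, f (V ω - μ) * g (V ω - μ) ∂ν = (∫ ω, f (V ω) * g (V ω) ∂ν) - f μ * g μ := by
  have hi := hV.integrable (by norm_num)
  have hf : ∫ ω, f (V ω) ∂ν = f μ := by rw [f.integral_comp_comm hi, hμ]
  have hg : ∫ ω, g (V ω) ∂ν = g μ := by rw [g.integral_comp_comm hi, hμ]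
  have h1 := (f.comp_memLp' hV)
  have h2 := (g.comp_memLp' hV)
  have := covariance_eq_sub h1 h2
  simp only [covariance, Function.comp_def, hf, hg, Pi.mul_apply] at this
  simpa using this

/-- Two independent samples have the same joint law as the first coordinates of two independent
infinite sequences. -/
lemma hasLaw_samples {Ω E : Type*} [MeasurableSpace Ω] [MeasurableSpace E] {m n : ℕ}
    {ρ : Measure Ω} {P Q : Measure E} [IsProbabilityMeasure P] [IsProbabilityMeasure Q]
    {X : Fin m → Ω → E} {Y : Fin n → Ω → E} (hX : ∀ i, HasLaw (X i) P ρ)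
    (hY : ∀ j, HasLaw (Y j) Q ρ) (hindep : iIndepFun (Sum.elim X Y) ρ) :
    HasLaw (fun ω => ((fun i => X i ω), fun j => Y j ω))
      (((Measure.infinitePi fun _ : ℕ => P).prod (Measure.infinitePi fun _ : ℕ => Q)).map
        fun z => ((fun i : Fin m => z.1 i), fun j : Fin n => z.2 j)) ρ := by
  have hlaw : ∀ s, HasLaw (Sum.elim X Y s) (Sum.elim (fun _ => P) (fun _ => Q) s) ρ := by
    rintro (i | j)
    exacts [hX i, hY j]
  have : ∀ s : Fin m ⊕ Fin n, IsProbabilityMeasure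
      (Sum.elim (fun _ => P) (fun _ => Q) s : Measure E) := by
    rintro (i | j) <;> simpa
  have h1 := (measurePreserving_sumPiEquivProdPi (X := fun _ : Fin m ⊕ Fin n => E)
    (Sum.elim (fun _ => P) (fun _ => Q))).comp_hasLaw (hindep.hasLaw_pi hlaw)
  have h2 : ((Measure.infinitePi fun _ : ℕ => P).prod (Measure.infinitePi fun _ : ℕ => Q)).map
      (fun z => ((fun i : Fin m => z.1 i), fun j : Fin n => z.2 j))
      = (Measure.pi fun _ : Fin m => P).prod (Measure.pi fun _ : Fin n => Q) := by
    rw [← Measure.infinitePi_eq_pi, ← Measure.infinitePi_eq_pi,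
      ← Measure.map_infinitePi_infinitePi_of_inj (P := fun _ : ℕ => P) (Fin.val_injective (n := m)),
      ← Measure.map_infinitePi_infinitePi_of_inj (P := fun _ : ℕ => Q) (Fin.val_injective (n := n)),
      Measure.map_prod_map _ _ (by fun_prop) (by fun_prop)]
    rfl
  rw [h2]
  exact h1

/-! ### The Wilcoxon–Mann–Whitney statistic -/

theorem theorem1 {E : Type u} [NormedAddCommGroup E] [NormedSpace ℝ E] [CompleteSpace E]
    [MeasurableSpace E] [BorelSpace E]
    (hsmooth : IsSmoothSpace E)
    (hsep : TopologicalSpace.SeparableSpace (StrongDual ℝ E))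
    (htype : IsTypeTwo (StrongDual ℝ E))
    (P Q : Measure E) [IsProbabilityMeasure P] [IsProbabilityMeasure Q]
    (m n : ℕ → ℕ) (γ : ℝ) (hγ : γ ∈ Set.Ioo (0 : ℝ) 1)
    (hm : Tendsto m atTop atTop) (hn : Tendsto n atTop atTop)
    (hmn : Tendsto (fun k => (m k : ℝ) / ((m k : ℝ) + (n k : ℝ))) atTop (𝓝 γ))
    {Ω : ℕ → Type v} [∀ k, MeasurableSpace (Ω k)]
    (ρ : (k : ℕ) → Measure (Ω k)) [∀ k, IsProbabilityMeasure (ρ k)]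
    (X : (k : ℕ) → Fin (m k) → Ω k → E) (Y : (k : ℕ) → Fin (n k) → Ω k → E)
    (hX : ∀ k i, HasLaw (X k i) P (ρ k)) (hY : ∀ k j, HasLaw (Y k j) Q (ρ k))
    (hindep : ∀ k, iIndepFun (Sum.elim (X k) (Y k)) (ρ k)) :
    ∃ G : ProbabilityMeasure (StrongDual ℝ E),
      IsGaussianWith (G : Measure (StrongDual ℝ E)) 0
        (fun f g => (1 - γ) * Gamma₁ P Q f g + γ * Gamma₂ P Q f g) ∧
      TendstoInDistribution
        (fun k ω => Real.sqrt ((m k : ℝ) * (n k : ℝ) / ((m k : ℝ) + (n k : ℝ))) •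
          (wmwStat (fun i => X k i ω) (fun j => Y k j ω) - wmwMean P Q))
        atTop id ρ (G : Measure (StrongDual ℝ E)) := by
  have hsepE := separableSpace_of_separableSpace_strongDual E
  have hscE : SecondCountableTopology E := UniformSpace.secondCountable_of_separable E
  have hscF : SecondCountableTopology (StrongDual ℝ E) :=
    UniformSpace.secondCountable_of_separable _
  have hS := hsmooth.measurable_SGN
  have hh : Measurable fun z : E × E => SGN (z.2 - z.1) :=
    hS.comp (measurable_snd.sub measurable_fst)
  have hc : ∀ z : E × E, ‖SGN (z.2 - z.1)‖ ≤ 1 := fun z => hsmooth.norm_SGN_le_one _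
  have hhi : Integrable (fun z : E × E => SGN (z.2 - z.1)) (P.prod Q) :=
    Integrable.of_bound hh.aestronglyMeasurable 1 (ae_of_all _ hc)
  obtain ⟨G, hG, hlim⟩ := htype.exists_tendstoInDistribution_twoSample P Q hh hc m n
    (Set.Ioo_subset_Icc_self hγ) hm hn hmn
  have hΓ₁ : ∀ f g, Gamma₁ P Q f g =
      ∫ x, f ((∫ y, SGN (y - x) ∂Q) - wmwMean P Q) * g ((∫ y, SGN (y - x) ∂Q) - wmwMean P Q) ∂P := by
    intro f g
    have hα : Measurable fun x => ∫ y, SGN (y - x) ∂Q :=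
      (hh.stronglyMeasurable.integral_prod_right' (ν := Q)).measurable
    rw [integral_dual_sub_mul_dual_sub (μ := wmwMean P Q) (MemLp.of_bound hα.aestronglyMeasurable 1
      (ae_of_all _ fun x => by
        simpa using norm_integral_le_of_norm_le_const (μ := Q) (ae_of_all _ fun y => hc (x, y))))
      (integral_prod _ hhi).symm, Gamma₁]
    congr 1
    have hae : condSGNLeft P Q =ᵐ[P.prod Q] fun z => ∫ y, SGN (y - z.1) ∂Q :=
      condExp_comap_fst_ae_eq hh.stronglyMeasurable hhi
    rw [integral_congr_ae (hae.mono fun z hz => by simp only [hz]; rfl)]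
    simpa using integral_fun_fst (μ := P) (ν := Q)
      fun x => f (∫ y, SGN (y - x) ∂Q) * g (∫ y, SGN (y - x) ∂Q)
  have hΓ₂ : ∀ f g, Gamma₂ P Q f g =
      ∫ y, f ((∫ x, SGN (y - x) ∂P) - wmwMean P Q) * g ((∫ x, SGN (y - x) ∂P) - wmwMean P Q) ∂Q := by
    intro f g
    have hβ : Measurable fun y => ∫ x, SGN (y - x) ∂P :=
      (hh.stronglyMeasurable.integral_prod_left' (μ := P)).measurable
    rw [integral_dual_sub_mul_dual_sub (μ := wmwMean P Q) (MemLp.of_bound hβ.aestronglyMeasurable 1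
      (ae_of_all _ fun y => by
        simpa using norm_integral_le_of_norm_le_const (μ := P) (ae_of_all _ fun x => hc (x, y))))
      (integral_prod_symm _ hhi).symm, Gamma₂]
    congr 1
    have hae : condSGNRight P Q =ᵐ[P.prod Q] fun z => ∫ x, SGN (z.2 - x) ∂P :=
      condExp_comap_snd_ae_eq hh.stronglyMeasurable hhi
    rw [integral_congr_ae (hae.mono fun z hz => by simp only [hz]; rfl)]
    simpa using integral_fun_snd (μ := P) (ν := Q)
      fun y => f (∫ x, SGN (y - x) ∂P) * g (∫ x, SGN (y - x) ∂P)
  refine ⟨G, ?_, ?_⟩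
  · simp only [hΓ₁, hΓ₂]
    exact hG
  · have hstat : ∀ k, Measurable fun w : (Fin (m k) → E) × (Fin (n k) → E) =>
        √((m k : ℝ) * (n k : ℝ) / ((m k : ℝ) + (n k : ℝ))) •
          (wmwStat w.1 w.2 - wmwMean P Q) := fun k => by
      have hsum : Measurable fun w : (Fin (m k) → E) × (Fin (n k) → E) =>
          ∑ i, ∑ j, SGN (w.2 j - w.1 i) :=
        Finset.measurable_fun_sum _ fun i _ => Finset.measurable_fun_sum _ fun j _ =>
          hS.comp (f := fun w : (Fin (m k) → E) × (Fin (n k) → E) => w.2 j - w.1 i) (by fun_prop)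
      exact ((hsum.const_smul ((m k : ℝ) * (n k : ℝ))⁻¹).sub_const (wmwMean P Q)).const_smul
        √((m k : ℝ) * (n k : ℝ) / ((m k : ℝ) + (n k : ℝ)))
    -- Only laws matter, so the samples may be replaced by coordinates of two infinite sequences.
    -- That model lives in the universe of E, where `IsTypeTwo` applies, whatever the universe of `Ω
    -- k`.
    have hlaw := fun k => hasLaw_samples (hX k) (hY k) (hindep k)
    have hmeas : ∀ k, AEMeasurable (fun ω =>
        √((m k : ℝ) * (n k : ℝ) / ((m k : ℝ) + (n k : ℝ))) •
          (wmwStat (fun i => X k i ω) (fun j => Y k j ω) - wmwMean P Q)) (ρ k) := fun k => by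
      have := (hstat k).comp_aemeasurable (hlaw k).aemeasurable
      exact this
    refine ⟨hmeas, by fun_prop, hlim.tendsto.congr fun k => Subtype.ext ?_⟩
    have h1 := AEMeasurable.map_map_of_aemeasurable (hstat k).aemeasurable (hlaw k).aemeasurable
    rw [(hlaw k).map_eq, Measure.map_map (hstat k) (by fun_prop)] at h1
    refine Eq.trans ?_ h1
    change Measure.map _ _ = Measure.map _ _
    congr 1
    ext1 z
    simp only [Function.comp_def, wmwStat, wmwMean, Finset.sum_range]
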